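/- Let $L^2(0,1)$ be the Hilbert space of square-integrable real functions on $(0,1)$. Let $J: L^2(0,1)\to L^2(0,1)$, $[Jx](s)=\int_0^s x(t)\,dt$, be the simple integration operator, $C: L^2(0,1)\to L^2(0,1)$, $[Cx](s)=\frac1s\int_0^s x(t)\,dt$, the continuous Cesàro operator (a bounded linear operator), and $A:=C\circ J$. Then $A$ is injective and compact and has a non-increasing sequence $(\sigma_n(A))_{n\ge 1}$ of positive singular values, counted with multiplicity; that is, there are orthonormal sequences $(u_n)$, $(v_n)$ in $L^2(0,1)$ with $Au_n=\sigma_n(A)v_n$ and $Ax=\sum_{n\ge1}\sigma_n(A)\langle u_n,x\rangle v_n$ for all $x\in L^2(0,1)$. For every such sequence $$\sigma_n(A)\asymp \frac1{n^2},$$ i.e. there are constants $0<\underline c\le\overline c<\infty$ with $\underline c\,n^{-2}\le\sigma_n(A)\le\overline c\,n^{-2}$ for all sufficiently large $n$. In other words, $A$ is ill-posed of degree exactly $2$: $$\liminf_{n\to\infty}\frac{-\log\sigma_n(A)}{\log n}=\limsup_{n\to\infty}\frac{-\log\sigma_n(A)}{\log n}=2 .$$ -/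

import Mathlib

open MeasureTheory Filter Topology Set
open scoped ENNReal InnerProductSpace

noncomputable section

namespace CesaroIllPosed

/-- Lebesgue measure on the interval `(0,1)`. -/
abbrev unitVolume : Measure ℝ := volume.restrict (Ioo (0 : ℝ) 1)

/-- The real Hilbert space `L²(0,1)`. -/
abbrev L2 : Type := Lp ℝ 2 unitVolume

/-! ### Boundedness of the two operators (Hardy's inequality) -/

lemma restrict_Iic {s : ℝ} (hs : s ∈ Ioo (0 : ℝ) 1) :
    unitVolume.restrict (Iic s) = volume.restrict (Ioc 0 s) := by
  rw [Measure.restrict_restrict measurableSet_Iic]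
  congr 1
  ext t
  simp only [mem_inter_iff, mem_Iic, mem_Ioo, mem_Ioc]
  constructor
  · rintro ⟨h1, h2, h3⟩; exact ⟨h2, h1⟩
  · rintro ⟨h1, h2⟩; exact ⟨h2, h1, lt_of_le_of_lt h2 hs.2⟩

lemma lintegral_rpow_Ioc {s : ℝ} (hs : 0 < s) :
    ∫⁻ t in Ioc 0 s, ENNReal.ofReal (t ^ (-(1 / 2) : ℝ)) = ENNReal.ofReal (2 * s ^ (1 / 2 : ℝ)) := by
  have hi : IntervalIntegrable (fun t : ℝ => t ^ (-(1 / 2) : ℝ)) volume 0 s :=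
    intervalIntegral.intervalIntegrable_rpow' (by norm_num)
  rw [← ofReal_integral_eq_lintegral_ofReal
    ((intervalIntegrable_iff_integrableOn_Ioc_of_le hs.le).1 hi)]
  · rw [← intervalIntegral.integral_of_le hs.le, integral_rpow (Or.inl (by norm_num))]
    congr 1
    rw [Real.zero_rpow (by norm_num)]
    norm_num
    ring
  · filter_upwards [ae_restrict_mem measurableSet_Ioc] with t ht
    exact Real.rpow_nonneg ht.1.le _

lemma lintegral_rpow_Ici {t : ℝ} (ht : 0 < t) :
    ∫⁻ s in Ici t, ENNReal.ofReal (2 * s ^ (-(3 / 2) : ℝ))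
      = ENNReal.ofReal (4 * t ^ (-(1 / 2) : ℝ)) := by
  rw [setLIntegral_congr Ioi_ae_eq_Ici.symm, ← ofReal_integral_eq_lintegral_ofReal]
  · rw [integral_const_mul, integral_Ioi_rpow_of_lt (by norm_num) ht]
    congr 1
    norm_num
    ring
  · exact (integrableOn_Ioi_rpow_of_lt (by norm_num) ht).const_mul 2
  · filter_upwards [ae_restrict_mem measurableSet_Ioi] with s hs
    have : 0 < s := ht.trans hs
    positivity

lemma cauchySchwarz_Ioc {g : ℝ → ℝ≥0∞} (hg : AEMeasurable g unitVolume)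
    {s : ℝ} (hs : s ∈ Ioo (0 : ℝ) 1) :
    (∫⁻ t in Ioc 0 s, g t) ^ 2 ≤ ENNReal.ofReal (2 * s ^ (1 / 2 : ℝ)) *
      ∫⁻ t in Ioc 0 s, ENNReal.ofReal (t ^ (1 / 2 : ℝ)) * g t ^ 2 := by
  have hg' : AEMeasurable g (volume.restrict (Ioc 0 s)) := by
    rw [← restrict_Iic hs]; exact hg.restrict
  have hp : ∀ r : ℝ, Measurable (fun t : ℝ => ENNReal.ofReal (t ^ r)) := fun r => by fun_prop
  have h := ENNReal.lintegral_mul_le_Lp_mul_Lq (volume.restrict (Ioc 0 s))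
    Real.HolderConjugate.two_two (f := fun t => ENNReal.ofReal (t ^ (-(1 / 4) : ℝ)))
    (g := fun t => ENNReal.ofReal (t ^ (1 / 4 : ℝ)) * g t)
    (hp _).aemeasurable ((hp _).aemeasurable.mul hg')
  have e1 : ∫⁻ t in Ioc 0 s, ((fun t => ENNReal.ofReal (t ^ (-(1 / 4) : ℝ))) *
      (fun t => ENNReal.ofReal (t ^ (1 / 4 : ℝ)) * g t)) t = ∫⁻ t in Ioc 0 s, g t := by
    refine setLIntegral_congr_fun measurableSet_Ioc fun t ht => ?_
    have ht0 : 0 < t := ht.1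
    simp only [Pi.mul_apply]
    rw [← mul_assoc, ← ENNReal.ofReal_mul (by positivity), ← Real.rpow_add ht0]
    norm_num
  have e2 : ∫⁻ t in Ioc 0 s, ENNReal.ofReal (t ^ (-(1 / 4) : ℝ)) ^ (2 : ℝ)
      = ENNReal.ofReal (2 * s ^ (1 / 2 : ℝ)) := by
    rw [← lintegral_rpow_Ioc hs.1]
    refine setLIntegral_congr_fun measurableSet_Ioc fun t ht => ?_
    have ht0 : 0 < t := ht.1
    rw [ENNReal.ofReal_rpow_of_pos (by positivity), ← Real.rpow_mul ht0.le]
    norm_num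
  have e3 : ∫⁻ t in Ioc 0 s, (ENNReal.ofReal (t ^ (1 / 4 : ℝ)) * g t) ^ (2 : ℝ)
      = ∫⁻ t in Ioc 0 s, ENNReal.ofReal (t ^ (1 / 2 : ℝ)) * g t ^ 2 := by
    refine setLIntegral_congr_fun measurableSet_Ioc fun t ht => ?_
    have ht0 : 0 < t := ht.1
    rw [ENNReal.mul_rpow_of_nonneg _ _ (by norm_num), ENNReal.rpow_two (g t),
      ENNReal.ofReal_rpow_of_pos (by positivity), ← Real.rpow_mul ht0.le]
    norm_num
  rw [e1, e2, e3] at h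
  have h2 := pow_le_pow_left' h 2
  refine h2.trans (le_of_eq ?_)
  rw [mul_pow, ← ENNReal.rpow_two, ← ENNReal.rpow_two, ← ENNReal.rpow_mul, ← ENNReal.rpow_mul]
  norm_num

/-- Hardy's inequality on `(0,1)`. -/
lemma hardy {g : ℝ → ℝ≥0∞} (hg : AEMeasurable g unitVolume) :
    ∫⁻ s, (ENNReal.ofReal s⁻¹ * ∫⁻ t in Ioc 0 s, g t) ^ 2 ∂unitVolume
      ≤ 4 * ∫⁻ t, g t ^ 2 ∂unitVolume := by
  have hm : ∀ c r : ℝ, Measurable (fun t : ℝ => ENNReal.ofReal (c * t ^ r)) :=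
    fun c r => by fun_prop
  have hm1 : ∀ r : ℝ, Measurable (fun t : ℝ => ENNReal.ofReal (t ^ r)) := fun r => by fun_prop
  calc ∫⁻ s, (ENNReal.ofReal s⁻¹ * ∫⁻ t in Ioc 0 s, g t) ^ 2 ∂unitVolume
      ≤ ∫⁻ s, (∫⁻ t, ({p : ℝ × ℝ | p.2 ≤ p.1}.indicator (fun p =>
          ENNReal.ofReal (2 * p.1 ^ (-(3 / 2) : ℝ)) *
            (ENNReal.ofReal (p.2 ^ (1 / 2 : ℝ)) * g p.2 ^ 2)) (s, t)) ∂unitVolume)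
          ∂unitVolume := by
        refine setLIntegral_mono' measurableSet_Ioo fun s hs => ?_
        have hs0 : 0 < s := hs.1
        have hind : ∀ t, ({p : ℝ × ℝ | p.2 ≤ p.1}.indicator (fun p =>
          ENNReal.ofReal (2 * p.1 ^ (-(3 / 2) : ℝ)) *
            (ENNReal.ofReal (p.2 ^ (1 / 2 : ℝ)) * g p.2 ^ 2)) (s, t))
            = (Iic s).indicator (fun t => ENNReal.ofReal (2 * s ^ (-(3 / 2) : ℝ)) *
            (ENNReal.ofReal (t ^ (1 / 2 : ℝ)) * g t ^ 2)) t := fun t => by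
          simp [indicator]
        simp_rw [hind]
        rw [lintegral_indicator measurableSet_Iic, restrict_Iic hs,
          lintegral_const_mul' _ _ ENNReal.ofReal_ne_top, mul_pow]
        refine (mul_le_mul_right (cauchySchwarz_Ioc hg hs) _).trans (le_of_eq ?_)
        rw [← mul_assoc, ← ENNReal.ofReal_pow (by positivity),
          ← ENNReal.ofReal_mul (by positivity)]
        congr 2
        rw [← Real.rpow_neg_one, ← Real.rpow_natCast, ← Real.rpow_mul hs0.le, mul_left_comm,
          ← Real.rpow_add hs0]
        norm_num
    _ = ∫⁻ t, (∫⁻ s, ({p : ℝ × ℝ | p.2 ≤ p.1}.indicator (fun p =>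
          ENNReal.ofReal (2 * p.1 ^ (-(3 / 2) : ℝ)) *
            (ENNReal.ofReal (p.2 ^ (1 / 2 : ℝ)) * g p.2 ^ 2)) (s, t)) ∂unitVolume)
          ∂unitVolume := by
        refine lintegral_lintegral_swap (f := fun s t => ({p : ℝ × ℝ | p.2 ≤ p.1}.indicator
          (fun p => ENNReal.ofReal (2 * p.1 ^ (-(3 / 2) : ℝ)) *
            (ENNReal.ofReal (p.2 ^ (1 / 2 : ℝ)) * g p.2 ^ 2)) (s, t))) ?_
        refine AEMeasurable.indicator ?_ (measurableSet_le measurable_snd measurable_fst)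
        exact ((hm _ _).comp measurable_fst).aemeasurable.mul
          (((hm1 _).comp measurable_snd).aemeasurable.mul (hg.comp_snd.pow_const 2))
    _ ≤ ∫⁻ t, 4 * g t ^ 2 ∂unitVolume := by
        refine setLIntegral_mono_ae' measurableSet_Ioo (Eventually.of_forall fun t ht => ?_)
        have ht0 : 0 < t := ht.1
        have hind : ∀ s, ({p : ℝ × ℝ | p.2 ≤ p.1}.indicator (fun p =>
          ENNReal.ofReal (2 * p.1 ^ (-(3 / 2) : ℝ)) *
            (ENNReal.ofReal (p.2 ^ (1 / 2 : ℝ)) * g p.2 ^ 2)) (s, t))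
            = (Ici t).indicator (fun s => ENNReal.ofReal (2 * s ^ (-(3 / 2) : ℝ))) s *
            (ENNReal.ofReal (t ^ (1 / 2 : ℝ)) * g t ^ 2) := fun s => by
          by_cases h : t ≤ s <;> simp [indicator, h]
        simp_rw [hind]
        rw [lintegral_mul_const _ ((hm _ _).indicator measurableSet_Ici),
          lintegral_indicator measurableSet_Ici, ← mul_assoc]
        refine mul_le_mul_left ?_ _
        refine (mul_le_mul_left ((lintegral_mono' (Measure.restrict_mono subset_rfl
          Measure.restrict_le_self) le_rfl).trans (lintegral_rpow_Ici ht0).le) _).trans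
          (le_of_eq ?_)
        rw [← ENNReal.ofReal_mul (by positivity), mul_assoc, ← Real.rpow_add ht0]
        norm_num
    _ = 4 * ∫⁻ t, g t ^ 2 ∂unitVolume := lintegral_const_mul' _ _ (by norm_num)

lemma integrableOn_L2 (x : L2) : IntegrableOn x (Ioo (0 : ℝ) 1) volume :=
  (Lp.memLp x).integrable (by norm_num)

lemma intervalIntegrable_L2 (x : L2) {s : ℝ} (hs : s ∈ Ioo (0 : ℝ) 1) :
    IntervalIntegrable x volume 0 s := by
  rw [intervalIntegrable_iff_integrableOn_Ioc_of_le hs.1.le]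
  exact (integrableOn_L2 x).mono_set fun t ht => ⟨ht.1, ht.2.trans_lt hs.2⟩

lemma aestronglyMeasurable_primitive (x : L2) :
    AEStronglyMeasurable (fun s => ∫ t in (0 : ℝ)..s, x t) unitVolume := by
  have h : IntervalIntegrable x volume 0 1 := by
    rw [intervalIntegrable_iff_integrableOn_Ioo_of_le zero_le_one]
    exact integrableOn_L2 x
  have hc := intervalIntegral.continuousOn_primitive_interval' h left_mem_uIcc
  rw [uIcc_of_le zero_le_one] at hc
  exact (hc.mono Ioo_subset_Icc_self).aestronglyMeasurable measurableSet_Ioo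

lemma eLpNorm_weighted_le (w : ℝ → ℝ) (hw : ∀ s ∈ Ioo (0 : ℝ) 1, |w s| ≤ s⁻¹) (x : L2) :
    eLpNorm (fun s => w s * ∫ t in (0 : ℝ)..s, x t) 2 unitVolume ≤ 2 * eLpNorm x 2 unitVolume := by
  have hsq : ∀ f : ℝ → ℝ, eLpNorm f 2 unitVolume
      = (∫⁻ s, ‖f s‖ₑ ^ 2 ∂unitVolume) ^ (1 / 2 : ℝ) := fun f => by
    rw [eLpNorm_eq_lintegral_rpow_enorm_toReal two_ne_zero ENNReal.ofNat_ne_top]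
    simp
  have h : ∫⁻ s, ‖w s * ∫ t in (0 : ℝ)..s, x t‖ₑ ^ 2 ∂unitVolume
      ≤ 4 * ∫⁻ s, ‖x s‖ₑ ^ 2 ∂unitVolume := by
    refine le_trans ?_ (hardy (Lp.aestronglyMeasurable x).enorm)
    refine setLIntegral_mono' measurableSet_Ioo fun s hs => ?_
    refine pow_le_pow_left' ?_ 2
    rw [enorm_mul]
    refine mul_le_mul' ?_ ?_
    · rw [Real.enorm_eq_ofReal_abs]
      exact ENNReal.ofReal_le_ofReal (hw s hs)
    · rw [intervalIntegral.integral_of_le hs.1.le]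
      exact enorm_integral_le_lintegral_enorm _
  rw [hsq, hsq]
  refine (ENNReal.rpow_le_rpow h (by norm_num)).trans (le_of_eq ?_)
  rw [ENNReal.mul_rpow_of_nonneg _ _ (by norm_num)]
  congr 1
  rw [show (4 : ℝ≥0∞) = 2 ^ (2 : ℝ) by norm_num, ← ENNReal.rpow_mul]
  norm_num

lemma memLp_integration (x : L2) :
    MemLp (fun s => ∫ t in (0 : ℝ)..s, x t) 2 unitVolume := by
  refine ⟨aestronglyMeasurable_primitive x, ?_⟩
  have h := eLpNorm_weighted_le (fun _ => 1)
    (fun s hs => by simpa using (one_le_inv₀ hs.1).2 hs.2.le) x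
  simp only [one_mul] at h
  exact h.trans_lt (ENNReal.mul_lt_top (by norm_num) (Lp.memLp x).2)

lemma memLp_cesaro (x : L2) :
    MemLp (fun s => 1 / s * ∫ t in (0 : ℝ)..s, x t) 2 unitVolume := by
  refine ⟨?_, ?_⟩
  · exact (by fun_prop : Measurable fun s : ℝ => 1 / s).aestronglyMeasurable.mul
      (aestronglyMeasurable_primitive x)
  · exact (eLpNorm_weighted_le (fun s => 1 / s)
      (fun s hs => by rw [one_div, abs_of_pos (inv_pos.2 hs.1)]) x).trans_lt
      (ENNReal.mul_lt_top (by norm_num) (Lp.memLp x).2)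

lemma norm_toLp_le {f : ℝ → ℝ} (hf : MemLp f 2 unitVolume) {x : L2}
    (h : eLpNorm f 2 unitVolume ≤ 2 * eLpNorm x 2 unitVolume) : ‖hf.toLp f‖ ≤ 2 * ‖x‖ := by
  rw [Lp.norm_toLp, Lp.norm_def]
  have := ENNReal.toReal_mono (ENNReal.mul_ne_top (by norm_num) (Lp.memLp x).2.ne) h
  simpa using this

lemma primitive_add (x y : L2) {s : ℝ} (hs : s ∈ Ioo (0 : ℝ) 1) :
    ∫ t in (0 : ℝ)..s, (x + y : L2) t = (∫ t in (0 : ℝ)..s, x t) + ∫ t in (0 : ℝ)..s, y t := by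
  rw [← intervalIntegral.integral_add (intervalIntegrable_L2 x hs) (intervalIntegrable_L2 y hs),
    intervalIntegral.integral_of_le hs.1.le, intervalIntegral.integral_of_le hs.1.le]
  refine integral_congr_ae ?_
  rw [← restrict_Iic hs]
  exact ae_restrict_of_ae (Lp.coeFn_add x y)

lemma primitive_smul (c : ℝ) (x : L2) {s : ℝ} (hs : s ∈ Ioo (0 : ℝ) 1) :
    ∫ t in (0 : ℝ)..s, (c • x : L2) t = c * ∫ t in (0 : ℝ)..s, x t := by
  rw [← intervalIntegral.integral_const_mul,
    intervalIntegral.integral_of_le hs.1.le, intervalIntegral.integral_of_le hs.1.le]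
  refine integral_congr_ae ?_
  rw [← restrict_Iic hs]
  exact ae_restrict_of_ae (Lp.coeFn_smul c x)

/-! ### The operators -/

/-- The simple integration operator `[Jx](s) = ∫₀ˢ x(t) dt` on `L²(0,1)`. -/
def integrationOp : L2 →L[ℝ] L2 :=
  LinearMap.mkContinuous
    { toFun := fun x => (memLp_integration x).toLp (fun s => ∫ t in (0 : ℝ)..s, x t)
      map_add' := fun x y => by
        rw [← MemLp.toLp_add, MemLp.toLp_eq_toLp_iff]
        filter_upwards [ae_restrict_mem measurableSet_Ioo] with s hs
        exact primitive_add x y hs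
      map_smul' := fun c x => by
        rw [RingHom.id_apply, ← MemLp.toLp_const_smul, MemLp.toLp_eq_toLp_iff]
        filter_upwards [ae_restrict_mem measurableSet_Ioo] with s hs
        exact primitive_smul c x hs }
    2 fun x => norm_toLp_le (memLp_integration x) <| by
      have h := eLpNorm_weighted_le (fun _ => 1)
        (fun s hs => by simpa using (one_le_inv₀ hs.1).2 hs.2.le) x
      simpa only [one_mul] using h

/-- The continuous Cesàro operator `[Cx](s) = (1/s) ∫₀ˢ x(t) dt` on `L²(0,1)`. -/
def cesaroOp : L2 →L[ℝ] L2 :=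
  LinearMap.mkContinuous
    { toFun := fun x => (memLp_cesaro x).toLp (fun s => 1 / s * ∫ t in (0 : ℝ)..s, x t)
      map_add' := fun x y => by
        rw [← MemLp.toLp_add, MemLp.toLp_eq_toLp_iff]
        filter_upwards [ae_restrict_mem measurableSet_Ioo] with s hs
        simp only [primitive_add x y hs, Pi.add_apply, mul_add]
      map_smul' := fun c x => by
        rw [RingHom.id_apply, ← MemLp.toLp_const_smul, MemLp.toLp_eq_toLp_iff]
        filter_upwards [ae_restrict_mem measurableSet_Ioo] with s hs
        simp only [primitive_smul c x hs, Pi.smul_apply, smul_eq_mul, mul_left_comm] }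
    2 fun x => norm_toLp_le (memLp_cesaro x) <|
      eLpNorm_weighted_le (fun s => 1 / s)
        (fun s hs => by rw [one_div, abs_of_pos (inv_pos.2 hs.1)]) x

/-! ### Singular values and degree of ill-posedness -/

section Singular

variable {X Y : Type*} [NormedAddCommGroup X] [InnerProductSpace ℝ X]
  [NormedAddCommGroup Y] [InnerProductSpace ℝ Y]

/-- `(σ, u, v)` is a singular system of the operator `A` (of infinite rank): the `u n` and the
`v n` are orthonormal, the `σ n` are positive and non-increasing, `A (u n) = σ n • v n`, and
`A x = ∑ₙ σₙ ⟨uₙ, x⟩ vₙ` for every `x`.  The index starts at `0`, so `σ n` is the `(n+1)`-st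
singular value. -/
structure IsSingularSystem (A : X →L[ℝ] Y) (σ : ℕ → ℝ) (u : ℕ → X) (v : ℕ → Y) : Prop where
  orthonormal_left : Orthonormal ℝ u
  orthonormal_right : Orthonormal ℝ v
  pos : ∀ n, 0 < σ n
  antitone : Antitone σ
  map_left : ∀ n, A (u n) = σ n • v n
  hasSum : ∀ x, HasSum (fun n => (σ n * ⟪u n, x⟫_ℝ) • v n) (A x)

/-- `σ` is the non-increasing sequence of the singular values of `A`, repeated according to
multiplicity; `σ n` is the `(n+1)`-st singular value. -/
def IsSingularValueSeq (A : X →L[ℝ] Y) (σ : ℕ → ℝ) : Prop :=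
  ∃ (u : ℕ → X) (v : ℕ → Y), IsSingularSystem A σ u v

/-- The left end point `liminf (-log σₙ) / log n` of the interval of ill-posedness; the `n`-th
entry of the sequence (`n ≥ 1`) is `σ (n - 1)`. -/
def lowerIllPosedness (σ : ℕ → ℝ) : EReal :=
  liminf (fun n : ℕ => ((-Real.log (σ (n - 1)) / Real.log n : ℝ) : EReal)) atTop

/-- The right end point `limsup (-log σₙ) / log n` of the interval of ill-posedness. -/
def upperIllPosedness (σ : ℕ → ℝ) : EReal :=
  limsup (fun n : ℕ => ((-Real.log (σ (n - 1)) / Real.log n : ℝ) : EReal)) atTop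

/-- The injective compact operator `A` is ill-posed of degree `μ ∈ (0,∞)`: its interval of
ill-posedness degenerates to the single point `μ`. -/
structure IsIllPosedOfDegree (A : X →L[ℝ] Y) (μ : ℝ) : Prop where
  injective : Function.Injective A
  compact : IsCompactOperator A
  degree_pos : 0 < μ
  exists_seq : ∃ σ, IsSingularValueSeq A σ
  lower_eq : ∀ σ, IsSingularValueSeq A σ → lowerIllPosedness σ = μ
  upper_eq : ∀ σ, IsSingularValueSeq A σ → upperIllPosedness σ = μ

end Singular

/-- `aₙ ≍ bₙ` for sequences `a, b` of positive numbers: `c bₙ ≤ aₙ ≤ C bₙ` for all sufficiently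
large `n`, with constants `0 < c ≤ C < ∞`. -/
def AsympEquiv (a b : ℕ → ℝ) : Prop :=
  ∃ c C : ℝ, 0 < c ∧ c ≤ C ∧ ∀ᶠ n in atTop, c * b n ≤ a n ∧ a n ≤ C * b n

end CesaroIllPosed

end

/-!
Write `A = C ∘ J`, so that `(Ax)(s) = s⁻¹ W(s)`, where `X = Jx` is the primitive of `x` and `W` the
primitive of `X`, both vanishing at `0`. The singular values are bounded from both sides by the
Courant–Fischer principle, used in two forms that speak only of finitely many orthogonality
conditions.

*Upper bound.* If `‖Ax‖ ≤ ε ‖x‖` whenever `x` is orthogonal to `m` given vectors, then the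
`(m+1)`-st singular value is at most `ε` (`le_of_forall_orthogonal_norm_le`). Here the vectors
express that `X` and `W` vanish at all nodes of the mesh `(j/n)²` of `[0,1]`; this takes `2n`
conditions. On a mesh interval `(a,b]` one then has `|(Ax)(s)| ≤ (s-a)/s · √(b-a) · ‖x‖_{(a,b)}`,
hence `‖Ax‖_{(a,b)} ≤ (b-a)²/b · ‖x‖_{(a,b)}`, and the quadratic grading towards the singular point
`s = 0` makes `(b-a)²/b ≤ 4/n²` uniformly over the mesh (`norm_cesaroOp_integrationOp_le`).
The same estimate approximates `A` in norm by operators of finite rank, so `A` is compact.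

*Lower bound.* Since `1/s ≥ 1`, `‖Ax‖ ≥ ‖J²x‖`. With `e_k = √2 cos((k+1)πs)` one has
`J² e_k = ((k+1)π)⁻² (√2 - e_k)`, and constants are orthogonal to all the `e_j`; so the compression
of `J²` to the span of `e_0, …, e_n` is diagonal, and `‖J²x‖ ≥ ((n+1)π)⁻² ‖x‖` on this span
(`mul_norm_sum_cosineVec_le`).

*Existence.* For a compact injective operator on an infinite-dimensional Hilbert space a singular
system is built greedily (`exists_isSingularValueSeq`): `u_n` maximizes `‖Au‖` over the unit vectors
orthogonal to `u_0, …, u_{n-1}`.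
-/

namespace CesaroIllPosed

/-! ### Singular values and finite-codimensional subspaces -/

section Abstract

variable {X Y : Type*} [NormedAddCommGroup X] [InnerProductSpace ℝ X]
  [NormedAddCommGroup Y] [InnerProductSpace ℝ Y]

lemma norm_sum_smul_sq {ι : Type*} [Fintype ι] {v : ι → X} (hv : Orthonormal ℝ v) (c : ι → ℝ) :
    ‖∑ i, c i • v i‖ ^ 2 = ∑ i, c i ^ 2 := by
  rw [← real_inner_self_eq_norm_sq, hv.inner_sum]
  simp [sq]

/-- Upper half of the Courant–Fischer principle: the span of `u_0, …, u_m` contains a non-zero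
vector that satisfies `m` orthogonality conditions. The expansion of `A` in `u` and `v` is not needed. -/
lemma le_of_forall_orthogonal_norm_le {A : X →L[ℝ] Y} {σ : ℕ → ℝ} {u : ℕ → X} {v : ℕ → Y}
    (hu : Orthonormal ℝ u) (hv : Orthonormal ℝ v) (hpos : ∀ n, 0 ≤ σ n) (hanti : Antitone σ)
    (hA : ∀ n, A (u n) = σ n • v n) {ι : Type*} [Fintype ι] (g : ι → X) {ε : ℝ}
    (h : ∀ x, (∀ i, ⟪g i, x⟫_ℝ = 0) → ‖A x‖ ≤ ε * ‖x‖) : σ (Fintype.card ι) ≤ ε := by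
  set n := Fintype.card ι
  have hu' : Orthonormal ℝ (fun k : Fin (n + 1) => u k) := hu.comp _ Fin.val_injective
  have hv' : Orthonormal ℝ (fun k : Fin (n + 1) => v k) := hv.comp _ Fin.val_injective
  let L : (Fin (n + 1) → ℝ) →ₗ[ℝ] X := Fintype.linearCombination ℝ (fun k : Fin (n + 1) => u k)
  let F : X →ₗ[ℝ] (ι → ℝ) := LinearMap.pi fun i => (innerSL ℝ (g i)).toLinearMap
  obtain ⟨c, hc, hc0⟩ := Submodule.exists_mem_ne_zero_of_ne_bot
    (LinearMap.ker_ne_bot_of_finrank_lt (f := F ∘ₗ L) (by simp [n]))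
  have hx := h (L c) fun i => congrFun (LinearMap.mem_ker.1 hc) i
  have hLc : L c = ∑ k, c k • u k := by simp [L, Fintype.linearCombination_apply]
  have hALc : A (L c) = ∑ k : Fin (n + 1), (σ k * c k) • v k := by
    rw [hLc, map_sum]
    exact Finset.sum_congr rfl fun k _ => by rw [map_smul, hA, smul_smul, mul_comm]
  have hn1 : ‖L c‖ ^ 2 = ∑ k, c k ^ 2 := by rw [hLc, norm_sum_smul_sq hu']
  have hn2 : ‖A (L c)‖ ^ 2 = ∑ k : Fin (n + 1), (σ k * c k) ^ 2 := by
    rw [hALc, norm_sum_smul_sq hv']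
  have hle : (σ n * ‖L c‖) ^ 2 ≤ ‖A (L c)‖ ^ 2 := by
    rw [mul_pow, hn1, hn2, Finset.mul_sum]
    refine Finset.sum_le_sum fun k _ => ?_
    rw [mul_pow]
    have := hanti (Nat.lt_succ_iff.1 k.2)
    have := hpos n
    gcongr
  have hle' := (abs_le_of_sq_le_sq' hle (norm_nonneg _)).2.trans hx
  refine le_of_mul_le_mul_right hle' ?_
  have : 0 < ‖L c‖ ^ 2 := by
    rw [hn1]
    obtain ⟨k, hk⟩ := Function.ne_iff.1 hc0
    exact Finset.sum_pos' (fun _ _ => sq_nonneg _) ⟨k, Finset.mem_univ _, sq_pos_of_ne_zero hk⟩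
  exact norm_pos_iff.2 fun h0 => by simp [h0] at this

lemma IsSingularSystem.norm_apply_le_of_orthogonal {A : X →L[ℝ] Y} {σ : ℕ → ℝ} {u : ℕ → X}
    {v : ℕ → Y} (h : IsSingularSystem A σ u v) {n : ℕ} {x : X}
    (hx : ∀ k < n, ⟪u k, x⟫_ℝ = 0) : ‖A x‖ ≤ σ n * ‖x‖ := by
  refine le_of_tendsto (h.hasSum x).norm (Eventually.of_forall fun S => ?_)
  refine abs_le_of_sq_le_sq' ?_ (mul_nonneg (h.pos n).le (norm_nonneg x)) |>.2
  rw [← real_inner_self_eq_norm_sq, h.orthonormal_right.inner_sum]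
  refine (Finset.sum_le_sum (g := fun k => σ n ^ 2 * ‖⟪u k, x⟫_ℝ‖ ^ 2) fun k _ => ?_).trans ?_
  · rcases lt_or_ge k n with hk | hk
    · simp [hx k hk]
    · have h1 := h.antitone hk
      have h2 := (h.pos k).le
      rw [conj_trivial, ← sq, mul_pow, Real.norm_eq_abs, sq_abs]
      gcongr
  · rw [← Finset.mul_sum, mul_pow]
    gcongr
    exact h.orthonormal_left.sum_inner_products_le x

/-- Lower half of the Courant–Fischer principle: an `(n+1)`-dimensional space contains a non-zero
vector orthogonal to `u_0, …, u_{n-1}`. -/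
lemma IsSingularSystem.le_of_forall_le_norm {A : X →L[ℝ] Y} {σ : ℕ → ℝ} {u : ℕ → X}
    {v : ℕ → Y} (h : IsSingularSystem A σ u v) {n : ℕ} {e : Fin (n + 1) → X}
    (he : Orthonormal ℝ e) {δ : ℝ} (hδ : ∀ c : Fin (n + 1) → ℝ,
      δ * ‖∑ k, c k • e k‖ ≤ ‖A (∑ k, c k • e k)‖) : δ ≤ σ n := by
  let L : (Fin (n + 1) → ℝ) →ₗ[ℝ] X := Fintype.linearCombination ℝ e
  let F : X →ₗ[ℝ] (Fin n → ℝ) := LinearMap.pi fun i => (innerSL ℝ (u i)).toLinearMap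
  obtain ⟨c, hc, hc0⟩ := Submodule.exists_mem_ne_zero_of_ne_bot
    (LinearMap.ker_ne_bot_of_finrank_lt (f := F ∘ₗ L) (by simp))
  have hLc : L c = ∑ k, c k • e k := by simp [L, Fintype.linearCombination_apply]
  have hx := h.norm_apply_le_of_orthogonal (n := n) (x := L c)
    fun k hk => congrFun (LinearMap.mem_ker.1 hc) ⟨k, hk⟩
  refine le_of_mul_le_mul_right ((hLc ▸ hδ c).trans hx) ?_
  refine norm_pos_iff.2 fun h0 => hc0 (funext fun k => ?_)
  rw [Pi.zero_apply, ← he.inner_right_fintype c k, ← hLc, h0, inner_zero_right]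

/-- Compactness criterion: with `P` the orthogonal projection onto the span of the `g i`, the
finite-rank operator `A P` is within `ε` of `A`. -/
lemma isCompactOperator_of_forall_orthogonal_norm_le [CompleteSpace Y] {A : X →L[ℝ] Y}
    (h : ∀ ε > 0, ∃ (m : ℕ) (g : Fin m → X),
      ∀ x, (∀ i, ⟪g i, x⟫_ℝ = 0) → ‖A x‖ ≤ ε * ‖x‖) : IsCompactOperator A := by
  have hpos : ∀ n : ℕ, (0 : ℝ) < 1 / (n + 1) := fun n => by positivity
  choose m g hg using fun n : ℕ => h _ (hpos n)
  let K : ℕ → Submodule ℝ X := fun n => Submodule.span ℝ (range (g n))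
  have : ∀ n, FiniteDimensional ℝ (K n) := fun n =>
    FiniteDimensional.span_of_finite ℝ (finite_range (g n))
  refine isCompactOperator_of_tendsto (F := fun n => A ∘L (K n).starProjection) (l := atTop) ?_
    (Eventually.of_forall fun n => ?_)
  · rw [tendsto_iff_norm_sub_tendsto_zero]
    refine squeeze_zero (fun _ => norm_nonneg _) (fun n => ?_)
      tendsto_one_div_add_atTop_nhds_zero_nat
    rw [norm_sub_rev]
    refine ContinuousLinearMap.opNorm_le_bound _ (hpos n).le fun x => ?_
    have hx : x - (K n).starProjection x ∈ (K n)ᗮ := Submodule.sub_starProjection_mem_orthogonal x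
    have h1 := hg n (x - (K n).starProjection x) fun i =>
      hx _ (Submodule.subset_span (mem_range_self i))
    rw [_root_.sub_apply, ContinuousLinearMap.comp_apply, ← map_sub]
    refine h1.trans (mul_le_mul_of_nonneg_left ?_ (hpos n).le)
    rw [← Submodule.starProjection_orthogonal_val]
    exact Submodule.norm_starProjection_apply_le _ x
  · have hid : IsCompactOperator (id : K n → K n) := isCompactOperator_id
    exact (hid.clm_comp (A ∘L (K n).subtypeL)).comp_clm (K n).orthogonalProjectionOnto

/-- The vectors `A (u n) = σ n • v n` have a convergent subsequence, and the distance of any two of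
them is at least either of the corresponding `σ n`. -/
lemma tendsto_zero_of_orthonormal_of_isCompactOperator {A : X →L[ℝ] Y}
    (hA : IsCompactOperator A) {σ : ℕ → ℝ} {u : ℕ → X} {v : ℕ → Y}
    (hu : Orthonormal ℝ u) (hv : Orthonormal ℝ v) (hpos : ∀ n, 0 ≤ σ n) (hanti : Antitone σ)
    (hAu : ∀ n, A (u n) = σ n • v n) : Tendsto σ atTop (𝓝 0) := by
  obtain ⟨K, hK, hAK⟩ := hA.image_closedBall_subset_compact 1
  obtain ⟨y, -, φ, hφ, hy⟩ := hK.tendsto_subseq fun n => hAK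
    (mem_image_of_mem A (mem_closedBall_zero_iff.2 (hu.1 n).le))
  have hdiff := (hy.sub (hy.comp (tendsto_add_atTop_nat 1))).norm
  rw [sub_self, norm_zero] at hdiff
  have hsub : Tendsto (σ ∘ φ) atTop (𝓝 0) := by
    refine squeeze_zero (fun n => hpos _) (fun n => ?_) hdiff
    have hne : φ n ≠ φ (n + 1) := (hφ (Nat.lt_succ_self n)).ne
    have h0 : ⟪A (u (φ n)), A (u (φ (n + 1)))⟫_ℝ = 0 := by
      rw [hAu, hAu, inner_smul_left, inner_smul_right, hv.2 hne]; simp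
    refine abs_le_of_sq_le_sq' ?_ (norm_nonneg _) |>.2
    simp only [Function.comp_apply]
    rw [norm_sub_sq_real, h0, hAu (φ n), norm_smul, hv.1, mul_one, Real.norm_eq_abs, sq_abs]
    nlinarith [sq_nonneg ‖A (u (φ (n + 1)))‖]
  have hinf := tendsto_atTop_ciInf hanti ⟨0, by rintro _ ⟨n, rfl⟩; exact hpos n⟩
  rwa [tendsto_nhds_unique hsub (hinf.comp hφ.tendsto_atTop)]

variable [CompleteSpace X] [CompleteSpace Y]

/-- A unit vector that nearly attains the norm of `B` is nearly an eigenvector of `B†B` for the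
eigenvalue `‖B‖²`. -/
lemma norm_adjoint_apply_sub_sq_le (B : X →L[ℝ] Y) {x : X} (hx : ‖x‖ ≤ 1) :
    ‖B.adjoint (B x) - ‖B‖ ^ 2 • x‖ ^ 2 ≤ ‖B‖ ^ 2 * (‖B‖ ^ 2 - ‖B x‖ ^ 2) := by
  have h1 : ‖B.adjoint (B x)‖ ≤ ‖B‖ * ‖B x‖ := by
    simpa using B.adjoint.le_opNorm (B x)
  have h2 : ⟪B.adjoint (B x), ‖B‖ ^ 2 • x⟫_ℝ = ‖B‖ ^ 2 * ‖B x‖ ^ 2 := by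
    rw [inner_smul_right, ContinuousLinearMap.adjoint_inner_left, real_inner_self_eq_norm_sq]
  have h3 : ‖‖B‖ ^ 2 • x‖ ≤ ‖B‖ ^ 2 := by
    rw [norm_smul, Real.norm_of_nonneg (by positivity)]
    exact mul_le_of_le_one_right (by positivity) hx
  rw [norm_sub_sq_real, h2]
  have h1' := pow_le_pow_left₀ (norm_nonneg _) h1 2
  have h3' := pow_le_pow_left₀ (norm_nonneg _) h3 2
  nlinarith

/-- A compact operator attains its norm. -/
lemma exists_norm_eq_one_norm_apply_eq_opNorm {B : X →L[ℝ] Y} (hB : IsCompactOperator B)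
    (hB0 : B ≠ 0) : ∃ u, ‖u‖ = 1 ∧ ‖B u‖ = ‖B‖ := by
  have hb : 0 < ‖B‖ := norm_pos_iff.2 hB0
  have hlt : ∀ n : ℕ, ‖B‖ - 1 / ((n : ℝ) + 1) < ‖B‖ := fun n => sub_lt_self _ (by positivity)
  choose x hx1 hx using fun n => B.exists_lt_apply_of_lt_opNorm (hlt n)
  have hlim : Tendsto (fun n => ‖B (x n)‖) atTop (𝓝 ‖B‖) := by
    refine tendsto_of_tendsto_of_tendsto_of_le_of_le (g := fun n : ℕ => ‖B‖ - 1 / ((n : ℝ) + 1))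
      (h := fun _ => ‖B‖) ?_ tendsto_const_nhds (fun n => (hx n).le) fun n => ?_
    · simpa using tendsto_one_div_add_atTop_nhds_zero_nat.const_sub ‖B‖
    · exact (B.le_opNorm _).trans (mul_le_of_le_one_right hb.le (hx1 n).le)
  have hres : Tendsto (fun n => B.adjoint (B (x n)) - ‖B‖ ^ 2 • x n) atTop (𝓝 0) := by
    rw [tendsto_zero_iff_norm_tendsto_zero]
    have h2 : Tendsto (fun n => ‖B.adjoint (B (x n)) - ‖B‖ ^ 2 • x n‖ ^ 2) atTop (𝓝 0) := by
      refine squeeze_zero (fun _ => by positivity)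
        (fun n => norm_adjoint_apply_sub_sq_le B (hx1 n).le) ?_
      have h := ((hlim.pow 2).const_sub (‖B‖ ^ 2)).const_mul (‖B‖ ^ 2)
      rwa [sub_self, mul_zero] at h
    simpa using h2.sqrt
  obtain ⟨K, hK, hBK⟩ := hB.image_closedBall_subset_compact 1
  obtain ⟨y, -, φ, hφ, hy⟩ := hK.tendsto_subseq fun n => hBK
    (mem_image_of_mem B (mem_closedBall_zero_iff.2 (hx1 n).le))
  have hxlim : Tendsto (x ∘ φ) atTop (𝓝 ((‖B‖ ^ 2)⁻¹ • B.adjoint y)) := by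
    have h1 := ((B.adjoint.continuous.tendsto y).comp hy).sub (hres.comp hφ.tendsto_atTop)
    refine (h1.const_smul (‖B‖ ^ 2)⁻¹).congr' (Eventually.of_forall fun n => ?_) |>.trans
      (le_of_eq ?_)
    · simp [smul_smul, hb.ne']
    · simp
  set u := (‖B‖ ^ 2)⁻¹ • B.adjoint y
  have hBu : ‖B u‖ = ‖B‖ := tendsto_nhds_unique ((B.continuous.tendsto u).comp hxlim).norm
    (hlim.comp hφ.tendsto_atTop)
  have hu : ‖u‖ ≤ 1 := le_of_tendsto hxlim.norm (Eventually.of_forall fun n => (hx1 _).le)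
  refine ⟨u, hu.antisymm ?_, hBu⟩
  have := B.le_opNorm u
  rw [hBu] at this
  exact le_of_mul_le_mul_left (by simpa using this) hb

/-- The greedy step: `A` attains its norm on the orthogonal complement of a finite-dimensional `W`,
and `A` preserves orthogonality to the maximizer there, because the maximizer is an eigenvector of
`B†B` for the restriction `B` of `A` to this complement. -/
lemma exists_maximizer {A : X →L[ℝ] Y} (hA : IsCompactOperator A) (hinj : Function.Injective A)
    (hdim : ¬ FiniteDimensional ℝ X) (W : Submodule ℝ X) [FiniteDimensional ℝ W] :
    ∃ u ∈ Wᗮ, ‖u‖ = 1 ∧ (∀ x ∈ Wᗮ, ‖A x‖ ≤ ‖A u‖ * ‖x‖) ∧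
      ∀ x ∈ Wᗮ, ⟪u, x⟫_ℝ = 0 → ⟪A u, A x⟫_ℝ = 0 := by
  have hW : Wᗮ ≠ ⊥ := fun h => by
    rw [Submodule.orthogonal_eq_bot_iff] at h
    subst h
    exact hdim (Module.finite_def.2 (Module.finite_def.1 (Module.Finite.equiv
      (Submodule.topEquiv : (⊤ : Submodule ℝ X) ≃ₗ[ℝ] X))))
  obtain ⟨w, hw, hw0⟩ := Submodule.exists_mem_ne_zero_of_ne_bot hW
  let B : Wᗮ →L[ℝ] Y := A ∘L (Wᗮ).subtypeL
  have hB0 : B ≠ 0 := fun h => hw0 (hinj (by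
    simpa [B] using congrArg (fun T : Wᗮ →L[ℝ] Y => T ⟨w, hw⟩) h))
  obtain ⟨u, hu1, hu⟩ := exists_norm_eq_one_norm_apply_eq_opNorm
    (hA.comp_clm (Wᗮ).subtypeL : IsCompactOperator B) hB0
  have heig : B.adjoint (B u) = ‖B‖ ^ 2 • u := by
    have h := norm_adjoint_apply_sub_sq_le B hu1.le
    rw [hu, sub_self, mul_zero] at h
    exact sub_eq_zero.1 (norm_eq_zero.1 (pow_eq_zero_iff two_ne_zero |>.1
      (le_antisymm h (sq_nonneg _))))
  refine ⟨u, u.2, hu1, fun x hx => ?_, fun x hx hux => ?_⟩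
  · have := B.le_opNorm ⟨x, hx⟩
    rwa [← hu] at this
  · change ⟪B u, B ⟨x, hx⟩⟫_ℝ = 0
    rw [← ContinuousLinearMap.adjoint_inner_left, heig, inner_smul_left]
    change _ * ⟪(u : X), x⟫_ℝ = 0
    rw [hux, mul_zero]

/-- Every compact injective operator on an infinite-dimensional Hilbert space has a singular system.
The space `W n` is the span of `u 0, …, u (n-1)`, and `u n` the maximizer chosen in its orthogonal
complement. -/
lemma exists_isSingularValueSeq {A : X →L[ℝ] Y} (hA : IsCompactOperator A)
    (hinj : Function.Injective A) (hdim : ¬ FiniteDimensional ℝ X) :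
    ∃ σ, IsSingularValueSeq A σ := by
  choose f hfW hf1 hfmax hforth using fun W : {W : Submodule ℝ X // FiniteDimensional ℝ W} =>
    have := W.2
    exists_maximizer hA hinj hdim W.1
  -- Finite-dimensionality is carried along in a subtype, so that the chosen maximizer `f W` can be
  -- used inside the recursion that defines `W`.
  let W : ℕ → {W : Submodule ℝ X // FiniteDimensional ℝ W} := fun n =>
    Nat.rec ⟨⊥, inferInstance⟩ (fun _ V => ⟨V.1 ⊔ Submodule.span ℝ {f V}, by
      have := V.2; infer_instance⟩) n
  let u : ℕ → X := fun n => f (W n)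
  let σ : ℕ → ℝ := fun n => ‖A (u n)‖
  let v : ℕ → Y := fun n => (σ n)⁻¹ • A (u n)
  have hsucc : ∀ n, (W (n + 1)).1 = (W n).1 ⊔ Submodule.span ℝ {u n} := fun n => rfl
  have hmono : Monotone fun n => (W n).1 := monotone_nat_of_le_succ fun n => by
    rw [hsucc]; exact le_sup_left
  have hmem : ∀ {k n}, k < n → u k ∈ (W n).1 := fun {k n} hkn => by
    refine hmono (Nat.succ_le_of_lt hkn) ?_
    change u k ∈ (W (k + 1)).1
    rw [hsucc]
    exact le_sup_right (a := (W k).1) (Submodule.mem_span_singleton_self (u k))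
  have hWorth : ∀ n x, (∀ k < n, ⟪u k, x⟫_ℝ = 0) → x ∈ (W n).1ᗮ := fun n => by
    induction n with
    | zero => intro x _; change x ∈ (⊥ : Submodule ℝ X)ᗮ; simp
    | succ n ih =>
      intro x hx
      rw [hsucc, ← Submodule.inf_orthogonal]
      exact ⟨ih x fun k hk => hx k (hk.trans n.lt_succ_self),
        Submodule.mem_orthogonal_singleton_iff_inner_right.2 (hx n n.lt_succ_self)⟩
  have hpos : ∀ n, 0 < σ n := fun n => norm_pos_iff.2 fun h0 => by
    have h1 : u n = 0 := hinj (by rw [h0, map_zero])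
    have h2 : ‖u n‖ = 1 := hf1 (W n)
    simp [h1] at h2
  have hanti : Antitone σ := antitone_nat_of_succ_le fun n => by
    have := hfmax (W n) (u (n + 1))
      (Submodule.orthogonal_le (hmono n.le_succ) (hfW (W (n + 1))))
    rwa [show ‖u (n + 1)‖ = 1 from hf1 _, mul_one] at this
  have hu0 : ∀ {k n}, k < n → ⟪u k, u n⟫_ℝ = 0 := fun hkn => hfW (W _) _ (hmem hkn)
  have hAu0 : ∀ {k n}, k < n → ⟪A (u k), A (u n)⟫_ℝ = 0 := fun {k n} hkn =>
    hforth (W k) (u n) (Submodule.orthogonal_le (hmono hkn.le) (hfW (W n))) (hu0 hkn)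
  have hu : Orthonormal ℝ u := ⟨fun n => hf1 _, fun k n hkn => by
    rcases hkn.lt_or_gt with h | h
    · exact hu0 h
    · rw [real_inner_comm]; exact hu0 h⟩
  have hv : Orthonormal ℝ v := ⟨fun n => by
    rw [norm_smul, norm_inv, Real.norm_of_nonneg (hpos n).le]
    exact inv_mul_cancel₀ (hpos n).ne', fun k n hkn => by
    change ⟪(σ k)⁻¹ • A (u k), (σ n)⁻¹ • A (u n)⟫_ℝ = 0
    rw [inner_smul_left, inner_smul_right]
    rcases hkn.lt_or_gt with h | h
    · rw [hAu0 h]; simp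
    · rw [real_inner_comm, hAu0 h]; simp⟩
  have hAu : ∀ n, A (u n) = σ n • v n := fun n => by
    simp only [v]; rw [smul_smul, mul_inv_cancel₀ (hpos n).ne', one_smul]
  have hσ : Tendsto σ atTop (𝓝 0) :=
    tendsto_zero_of_orthonormal_of_isCompactOperator hA hu hv (fun n => (hpos n).le) hanti hAu
  refine ⟨σ, u, v, hu, hv, hpos, hanti, hAu, fun x => ?_⟩
  have hsummable : Summable fun n => (σ n * ⟪u n, x⟫_ℝ) • v n := by
    refine (hv.orthogonalFamily.summable_iff_norm_sq_summable fun n => σ n * ⟪u n, x⟫_ℝ).2 ?_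
    refine Summable.of_nonneg_of_le (fun _ => sq_nonneg _) (fun n => ?_)
      ((hu.inner_products_summable x).mul_left (σ 0 ^ 2))
    rw [norm_mul, mul_pow, Real.norm_of_nonneg (hpos n).le]
    have := hanti (Nat.zero_le n)
    have := (hpos n).le
    gcongr
  -- The remainder `x - p` lies in `(W n)ᗮ`, where `A` has norm at most `σ n`.
  have hpartial : Tendsto (fun n => ∑ k ∈ Finset.range n, (σ k * ⟪u k, x⟫_ℝ) • v k) atTop
      (𝓝 (A x)) := by
    rw [tendsto_iff_norm_sub_tendsto_zero]
    refine squeeze_zero (fun _ => norm_nonneg _) (fun n => ?_) (by simpa using hσ.mul_const ‖x‖)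
    set p := ∑ k ∈ Finset.range n, ⟪u k, x⟫_ℝ • u k with hp
    have hAp : ∑ k ∈ Finset.range n, (σ k * ⟪u k, x⟫_ℝ) • v k = A p := by
      rw [hp, map_sum]
      exact Finset.sum_congr rfl fun k _ => by rw [map_smul, hAu k, mul_smul, smul_comm]
    have hk : ∀ k < n, ⟪u k, x - p⟫_ℝ = 0 := fun k hk => by
      rw [inner_sub_right, hp, hu.inner_right_sum _ (Finset.mem_range.2 hk), sub_self]
    have hpx : ⟪p, x - p⟫_ℝ = 0 := by
      rw [hp, sum_inner]
      exact Finset.sum_eq_zero fun k hkn => by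
        rw [inner_smul_left, hk k (Finset.mem_range.1 hkn), mul_zero]
    have hle : ‖x - p‖ ≤ ‖x‖ := by
      refine abs_le_of_sq_le_sq' ?_ (norm_nonneg _) |>.2
      have := norm_add_sq_real p (x - p)
      rw [hpx, add_sub_cancel] at this
      nlinarith [sq_nonneg ‖p‖]
    rw [hAp, norm_sub_rev, ← map_sub]
    exact (hfmax (W n) _ (hWorth n _ hk)).trans (mul_le_mul_of_nonneg_left hle (hpos n).le)
  have := tendsto_nhds_unique hsummable.hasSum.tendsto_sum_nat hpartial
  exact this ▸ hsummable.hasSum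

end Abstract

/-! ### Integrals and elements of `L²(0,1)` -/

lemma ae_Ioc_of_ae_unitVolume {p : ℝ → Prop} (h : ∀ᵐ s ∂unitVolume, p s) :
    ∀ᵐ s ∂volume, s ∈ Ioc (0 : ℝ) 1 → p s := by
  rw [ae_restrict_congr_set Ioo_ae_eq_Ioc, ae_restrict_iff' measurableSet_Ioc] at h
  exact h

lemma uIoc_subset_Ioc {a b : ℝ} (ha : a ∈ Icc (0 : ℝ) 1) (hb : b ∈ Icc (0 : ℝ) 1) :
    uIoc a b ⊆ Ioc 0 1 := fun _ ht =>
  ⟨(le_inf ha.1 hb.1).trans_lt ht.1, ht.2.trans (sup_le ha.2 hb.2)⟩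

lemma intervalIntegral_congr_ae_unitVolume {f g : ℝ → ℝ} (h : f =ᵐ[unitVolume] g) {a b : ℝ}
    (ha : a ∈ Icc (0 : ℝ) 1) (hb : b ∈ Icc (0 : ℝ) 1) : ∫ t in a..b, f t = ∫ t in a..b, g t :=
  intervalIntegral.integral_congr_ae <| by
    filter_upwards [ae_Ioc_of_ae_unitVolume h] with t ht hmem
    exact ht (uIoc_subset_Ioc ha hb hmem)

lemma integral_unitVolume (f : ℝ → ℝ) : ∫ t, f t ∂unitVolume = ∫ t in (0 : ℝ)..1, f t := by
  rw [intervalIntegral.integral_of_le zero_le_one, integral_Ioc_eq_integral_Ioo]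

lemma intervalIntegrable_of_integrable {f : ℝ → ℝ} (hf : Integrable f unitVolume) {a b : ℝ}
    (ha : a ∈ Icc (0 : ℝ) 1) (hb : b ∈ Icc (0 : ℝ) 1) : IntervalIntegrable f volume a b := by
  rw [intervalIntegrable_iff]
  have h : IntegrableOn f (Ioc 0 1) := (integrableOn_Ioc_iff_integrableOn_Ioo (by simp)).2 hf
  exact h.mono_set (uIoc_subset_Ioc ha hb)

lemma intervalIntegrable_coeFn (x : L2) {a b : ℝ} (ha : a ∈ Icc (0 : ℝ) 1)
    (hb : b ∈ Icc (0 : ℝ) 1) : IntervalIntegrable x volume a b :=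
  intervalIntegrable_of_integrable (integrableOn_L2 x) ha hb

lemma continuousOn_primitive (x : L2) :
    ContinuousOn (fun s => ∫ t in (0 : ℝ)..s, x t) (Icc 0 1) := by
  have h := intervalIntegral.continuousOn_primitive_interval'
    (intervalIntegrable_coeFn x ⟨le_rfl, zero_le_one⟩ ⟨zero_le_one, le_rfl⟩) left_mem_uIcc
  rwa [uIcc_of_le zero_le_one] at h

lemma coeFn_integrationOp (x : L2) :
    integrationOp x =ᵐ[unitVolume] fun s => ∫ t in (0 : ℝ)..s, x t :=
  (memLp_integration x).coeFn_toLp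

lemma coeFn_cesaroOp (x : L2) :
    cesaroOp x =ᵐ[unitVolume] fun s => 1 / s * ∫ t in (0 : ℝ)..s, x t :=
  (memLp_cesaro x).coeFn_toLp

lemma intervalIntegral_integrationOp (x : L2) {a b : ℝ} (ha : a ∈ Icc (0 : ℝ) 1)
    (hb : b ∈ Icc (0 : ℝ) 1) :
    ∫ t in a..b, integrationOp x t = ∫ t in a..b, ∫ r in (0 : ℝ)..t, x r :=
  intervalIntegral_congr_ae_unitVolume (coeFn_integrationOp x) ha hb

lemma norm_sq_eq_intervalIntegral (x : L2) : ‖x‖ ^ 2 = ∫ t in (0 : ℝ)..1, x t ^ 2 := by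
  rw [← real_inner_self_eq_norm_sq, L2.inner_def, ← integral_unitVolume]
  simp [sq]

lemma inner_toLp {f g : ℝ → ℝ} (hf : MemLp f 2 unitVolume) (hg : MemLp g 2 unitVolume) :
    ⟪hf.toLp f, hg.toLp g⟫_ℝ = ∫ t in (0 : ℝ)..1, f t * g t := by
  rw [L2.inner_def, ← integral_unitVolume]
  refine integral_congr_ae ?_
  filter_upwards [hf.coeFn_toLp, hg.coeFn_toLp] with t h1 h2
  rw [h1, h2]
  simp [mul_comm]

/-! ### Injectivity -/

lemma eq_zero_of_primitive_ae_eq_zero {x : L2}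
    (h : (fun s => ∫ t in (0 : ℝ)..s, x t) =ᵐ[unitVolume] 0) : x = 0 := by
  have h0 : EqOn (fun s => ∫ t in (0 : ℝ)..s, x t) 0 (Ioo 0 1) :=
    Measure.eqOn_Ioo_of_ae_eq volume h
      ((continuousOn_primitive x).mono Ioo_subset_Icc_self) continuousOn_const
  have hint := intervalIntegrable_coeFn x (a := 0) (b := 1) ⟨le_rfl, zero_le_one⟩
    ⟨zero_le_one, le_rfl⟩
  rw [Lp.eq_zero_iff_ae_eq_zero]
  refine (ae_restrict_iff' measurableSet_Ioo).2 ?_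
  filter_upwards [hint.ae_hasDerivAt_integral] with s hs hmem
  rw [uIcc_of_le zero_le_one] at hs
  have hd := hs (Ioo_subset_Icc_self hmem) 0 ⟨le_rfl, zero_le_one⟩
  have hd0 : HasDerivAt (fun s => ∫ t in (0 : ℝ)..s, x t) 0 s :=
    (hasDerivAt_const s (0 : ℝ)).congr_of_eventuallyEq
      (eventually_of_mem (isOpen_Ioo.mem_nhds hmem) h0)
  exact hd.unique hd0

lemma integrationOp_injective : Function.Injective integrationOp :=
  (injective_iff_map_eq_zero _).2 fun x hx => eq_zero_of_primitive_ae_eq_zero <|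
    (coeFn_integrationOp x).symm.trans ((Lp.eq_zero_iff_ae_eq_zero).1 hx)

lemma cesaroOp_injective : Function.Injective cesaroOp := by
  refine (injective_iff_map_eq_zero _).2 fun x hx => eq_zero_of_primitive_ae_eq_zero ?_
  have h := (coeFn_cesaroOp x).symm.trans ((Lp.eq_zero_iff_ae_eq_zero).1 hx)
  filter_upwards [h, ae_restrict_mem measurableSet_Ioo] with s hs hmem
  exact (mul_eq_zero.1 hs).resolve_left (one_div_pos.2 hmem.1).ne'

lemma norm_integrationOp_le_norm_cesaroOp (x : L2) : ‖integrationOp x‖ ≤ ‖cesaroOp x‖ := by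
  refine Lp.norm_le_norm_of_ae_le ?_
  filter_upwards [coeFn_integrationOp x, coeFn_cesaroOp x, ae_restrict_mem measurableSet_Ioo]
    with s h1 h2 hs
  rw [h1, h2, norm_mul]
  refine le_mul_of_one_le_left (norm_nonneg _) ?_
  rw [Real.norm_of_nonneg (one_div_pos.2 hs.1).le, one_div]
  exact (one_le_inv₀ hs.1).2 hs.2.le

/-! ### The cosine system -/

lemma memLp_of_continuous {f : ℝ → ℝ} (hf : Continuous f) : MemLp f 2 unitVolume := by
  obtain ⟨C, hC⟩ := (isCompact_Icc (a := (0 : ℝ)) (b := 1)).exists_bound_of_continuousOn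
    hf.continuousOn
  refine MemLp.of_bound hf.aestronglyMeasurable C ?_
  filter_upwards [ae_restrict_mem measurableSet_Ioo] with s hs
  exact hC s (Ioo_subset_Icc_self hs)

/-- The `k`-th member of the orthonormal system `√2 cos((k+1)πs)` of `L²(0,1)`. The constant
function is left out, so the index is shifted by one. -/
noncomputable def cosineVec (k : ℕ) : L2 :=
  (memLp_of_continuous (f := fun s => √2 * Real.cos ((k + 1) * Real.pi * s))
    (by fun_prop)).toLp _

/-- The constant function `√2` as an element of `L²(0,1)`. -/
noncomputable def constVec : L2 :=
  (memLp_of_continuous (f := fun _ => √2) continuous_const).toLp _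

lemma integral_cos_mul {a : ℝ} (ha : a ≠ 0) (s : ℝ) :
    ∫ t in (0 : ℝ)..s, Real.cos (a * t) = Real.sin (a * s) / a := by
  rw [intervalIntegral.integral_comp_mul_left (fun t => Real.cos t) ha, integral_cos]
  simp [div_eq_inv_mul]

lemma integral_sin_mul {a : ℝ} (ha : a ≠ 0) (s : ℝ) :
    ∫ t in (0 : ℝ)..s, Real.sin (a * t) = (1 - Real.cos (a * s)) / a := by
  rw [intervalIntegral.integral_comp_mul_left (fun t => Real.sin t) ha, integral_sin]
  simp [div_eq_inv_mul]

lemma integral_cos_int_mul_pi {m : ℤ} (hm : m ≠ 0) :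
    ∫ t in (0 : ℝ)..1, Real.cos (m * Real.pi * t) = 0 := by
  rw [integral_cos_mul (mul_ne_zero (Int.cast_ne_zero.2 hm) Real.pi_ne_zero), mul_one,
    Real.sin_int_mul_pi, zero_div]

lemma orthonormal_cosineVec : Orthonormal ℝ cosineVec := by
  have key : ∀ j k : ℕ, ⟪cosineVec j, cosineVec k⟫_ℝ =
      (∫ t in (0 : ℝ)..1, Real.cos (((j - k : ℤ) : ℝ) * Real.pi * t)) +
      ∫ t in (0 : ℝ)..1, Real.cos (((j + k + 2 : ℤ) : ℝ) * Real.pi * t) := fun j k => by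
    rw [cosineVec, cosineVec, inner_toLp, ← intervalIntegral.integral_add
      (Continuous.intervalIntegrable (by fun_prop) _ _)
      (Continuous.intervalIntegrable (by fun_prop) _ _)]
    refine intervalIntegral.integral_congr fun t _ => ?_
    have h1 : ((j - k : ℤ) : ℝ) * Real.pi * t
        = (j + 1) * Real.pi * t - (k + 1) * Real.pi * t := by push_cast; ring
    have h2 : ((j + k + 2 : ℤ) : ℝ) * Real.pi * t
        = (j + 1) * Real.pi * t + (k + 1) * Real.pi * t := by push_cast; ring
    simp only [h1, h2, Real.cos_sub, Real.cos_add]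
    have := Real.mul_self_sqrt (zero_le_two : (0 : ℝ) ≤ 2)
    linear_combination (Real.cos ((j + 1) * Real.pi * t) *
      Real.cos ((k + 1) * Real.pi * t)) * this
  rw [orthonormal_iff_ite]
  intro j k
  rw [key, integral_cos_int_mul_pi (m := j + k + 2) (by omega), add_zero]
  split_ifs with h
  · subst h; simp
  · exact integral_cos_int_mul_pi (by omega)

lemma inner_cosineVec_constVec (k : ℕ) : ⟪cosineVec k, constVec⟫_ℝ = 0 := by
  rw [cosineVec, constVec, inner_toLp]
  have := integral_cos_int_mul_pi (m := k + 1) (by omega)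
  push_cast at this
  simp [this]

lemma integrationOp_integrationOp_cosineVec (k : ℕ) :
    integrationOp (integrationOp (cosineVec k))
      = (((k + 1) * Real.pi) ^ 2)⁻¹ • (constVec - cosineVec k) := by
  have ha : ((k : ℝ) + 1) * Real.pi ≠ 0 := by positivity
  have h1 := (memLp_of_continuous (f := fun s => √2 * Real.cos ((k + 1) * Real.pi * s))
    (by fun_prop)).coeFn_toLp
  have h2 := (memLp_of_continuous (f := fun _ => √2) continuous_const).coeFn_toLp
  refine Lp.ext ?_
  filter_upwards [coeFn_integrationOp (integrationOp (cosineVec k)), h1, h2,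
    Lp.coeFn_smul (((k + 1) * Real.pi) ^ 2)⁻¹ (constVec - cosineVec k),
    Lp.coeFn_sub constVec (cosineVec k), ae_restrict_mem measurableSet_Ioo]
    with s e0 e1 e2 e3 e4 hs
  have hs' := Ioo_subset_Icc_self hs
  have h0 : (0 : ℝ) ∈ Icc (0 : ℝ) 1 := ⟨le_rfl, zero_le_one⟩
  rw [e0, e3, Pi.smul_apply, e4, Pi.sub_apply, constVec, e2,
    intervalIntegral_integrationOp _ h0 hs']
  have hin : ∀ t ∈ uIcc 0 s, ∫ r in (0 : ℝ)..t, cosineVec k r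
      = √2 / ((k + 1) * Real.pi) * Real.sin ((k + 1) * Real.pi * t) := fun t ht => by
    rw [uIcc_of_le hs.1.le] at ht
    rw [cosineVec, intervalIntegral_congr_ae_unitVolume h1 h0 ⟨ht.1, ht.2.trans hs.2.le⟩,
      intervalIntegral.integral_const_mul, integral_cos_mul ha]
    ring
  rw [intervalIntegral.integral_congr hin, intervalIntegral.integral_const_mul,
    integral_sin_mul ha, cosineVec, e1, smul_eq_mul]
  field_simp

/-- The compression of `J²` to the span of the first cosines is diagonal. -/
lemma inner_cosineVec_integrationOp_sum {n : ℕ} (c : Fin n → ℝ) (i : Fin n) :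
    ⟪cosineVec i, integrationOp (integrationOp (∑ k, c k • cosineVec k))⟫_ℝ
      = -((((i : ℕ) + 1) * Real.pi) ^ 2)⁻¹ * c i := by
  simp only [map_sum, map_smul, inner_sum, inner_smul_right,
    integrationOp_integrationOp_cosineVec, inner_sub_right, inner_cosineVec_constVec,
    orthonormal_iff_ite.1 orthonormal_cosineVec, Fin.val_inj]
  simp
  ring

lemma mul_norm_sum_cosineVec_le {n : ℕ} (c : Fin (n + 1) → ℝ) :
    (((n + 1) * Real.pi) ^ 2)⁻¹ * ‖∑ k, c k • cosineVec k‖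
      ≤ ‖cesaroOp (integrationOp (∑ k, c k • cosineVec k))‖ := by
  refine le_trans ?_ (norm_integrationOp_le_norm_cesaroOp _)
  have he : Orthonormal ℝ fun k : Fin (n + 1) => cosineVec k :=
    orthonormal_cosineVec.comp _ Fin.val_injective
  refine abs_le_of_sq_le_sq' ?_ (norm_nonneg _) |>.2
  refine le_trans ?_ (he.sum_inner_products_le (s := Finset.univ) _)
  rw [mul_pow, norm_sum_smul_sq he, Finset.mul_sum]
  refine Finset.sum_le_sum fun i _ => ?_
  rw [inner_cosineVec_integrationOp_sum, Real.norm_eq_abs, sq_abs, neg_mul, neg_sq, mul_pow _ (c i)]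
  have : ((i : ℕ) : ℝ) ≤ n := by exact_mod_cast Nat.lt_succ_iff.1 i.2
  have := Real.pi_pos
  gcongr

lemma not_finiteDimensional_L2 : ¬ FiniteDimensional ℝ L2 := fun _ =>
  have := orthonormal_cosineVec.linearIndependent.finite
  not_finite ℕ

/-! ### A quadratically graded mesh -/

lemma sq_intervalIntegral_le {f : ℝ → ℝ} {a b : ℝ} (hab : a ≤ b)
    (hf : IntervalIntegrable f volume a b)
    (hf2 : IntervalIntegrable (fun t => f t ^ 2) volume a b) :
    (∫ t in a..b, f t) ^ 2 ≤ (b - a) * ∫ t in a..b, f t ^ 2 := by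
  rcases hab.eq_or_lt with rfl | hlt
  · simp
  have hd : 0 < b - a := sub_pos.2 hlt
  set m := ∫ t in a..b, f t with hm
  -- Expand `∫ (f - mean)² ≥ 0`.
  have h : 0 ≤ ∫ t in a..b, ((f t ^ 2 - 2 * (m / (b - a)) * f t) + (m / (b - a)) ^ 2) :=
    intervalIntegral.integral_nonneg hab fun t _ => by
      nlinarith [sq_nonneg (f t - m / (b - a))]
  rw [intervalIntegral.integral_add (hf2.sub (hf.const_mul _)) intervalIntegrable_const,
    intervalIntegral.integral_sub hf2 (hf.const_mul _), intervalIntegral.integral_const_mul,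
    intervalIntegral.integral_const, ← hm, smul_eq_mul] at h
  have e : (b - a) * ((∫ t in a..b, f t ^ 2) - 2 * (m / (b - a)) * m
      + (b - a) * (m / (b - a)) ^ 2) = (b - a) * (∫ t in a..b, f t ^ 2) - m ^ 2 := by
    field_simp
    ring
  have := mul_nonneg hd.le h
  rw [e] at this
  linarith

/-- The nodes `(j/n)²`, `0 ≤ j ≤ n`, of the mesh of `[0,1]`. -/
noncomputable def node (n j : ℕ) : ℝ := ((j : ℝ) / n) ^ 2

lemma node_mem_Icc {n j : ℕ} (hj : j ≤ n) : node n j ∈ Icc (0 : ℝ) 1 := by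
  refine ⟨sq_nonneg _, pow_le_one₀ (by positivity) (div_le_one_of_le₀ ?_ (by positivity))⟩
  exact_mod_cast hj

lemma node_lt_node_succ {n : ℕ} (hn : 0 < n) (j : ℕ) : node n j < node n (j + 1) := by
  have : (0 : ℝ) < n := by exact_mod_cast hn
  unfold node
  push_cast
  gcongr
  linarith

lemma node_sub_sq_div_le {n : ℕ} (hn : 0 < n) (j : ℕ) :
    (node n (j + 1) - node n j) ^ 2 / node n (j + 1) ≤ 4 / (n : ℝ) ^ 2 := by
  have hn' : (0 : ℝ) < n := by exact_mod_cast hn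
  have hj : (0 : ℝ) < (j : ℝ) + 1 := by positivity
  have e : (node n (j + 1) - node n j) ^ 2 / node n (j + 1)
      = ((2 * j + 1) / ((j : ℝ) + 1)) ^ 2 / (n : ℝ) ^ 2 := by
    unfold node
    push_cast
    field_simp
    ring
  rw [e]
  gcongr
  rw [show (4 : ℝ) = 2 ^ 2 by norm_num]
  have : (2 * (j : ℝ) + 1) / (j + 1) ≤ 2 := by rw [div_le_iff₀ hj]; linarith
  gcongr

/-- If the primitive `X` of `x` and the primitive of `X` both vanish at the left end `a` of an
interval, then on this interval `(Ax)(s)` only sees the values of `x` to the right of `a`. -/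
lemma sq_average_primitive_le {x : L2} {a b : ℝ} (ha : a ∈ Icc (0 : ℝ) 1)
    (hb : b ∈ Icc (0 : ℝ) 1) (hX : ∫ t in (0 : ℝ)..a, x t = 0)
    (hW : ∫ t in (0 : ℝ)..a, ∫ r in (0 : ℝ)..t, x r = 0) {s : ℝ} (hs : s ∈ Ioc a b) :
    (1 / s * ∫ t in (0 : ℝ)..s, ∫ r in (0 : ℝ)..t, x r) ^ 2
      ≤ ((b - a) / b) ^ 2 * ((b - a) * ∫ t in a..b, x t ^ 2) := by
  have h0 : (0 : ℝ) ∈ Icc (0 : ℝ) 1 := ⟨le_rfl, zero_le_one⟩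
  have hs0 : 0 < s := ha.1.trans_lt hs.1
  have hb0 : 0 < b := hs0.trans_le hs.2
  have hs1 : s ∈ Icc (0 : ℝ) 1 := ⟨hs0.le, hs.2.trans hb.2⟩
  have hsq : Integrable (fun t => x t ^ 2) unitVolume := (Lp.memLp x).integrable_sq
  set M := (b - a) * ∫ t in a..b, x t ^ 2 with hM
  have hint0 : ∀ {c d : ℝ}, c ≤ d → 0 ≤ ∫ t in c..d, x t ^ 2 := fun hcd =>
    intervalIntegral.integral_nonneg hcd fun t _ => sq_nonneg _
  have hab : a ≤ b := (hs.1.trans_le hs.2).le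
  have hM0 : 0 ≤ M := mul_nonneg (sub_nonneg.2 hab) (hint0 hab)
  have hXle : ∀ t ∈ uIoc a s, ‖∫ r in (0 : ℝ)..t, x r‖ ≤ √M := fun t ht => by
    rw [uIoc_of_le hs.1.le] at ht
    have ht1 : t ∈ Icc (0 : ℝ) 1 := ⟨(ha.1.trans_lt ht.1).le, ht.2.trans hs1.2⟩
    have htb : t ≤ b := ht.2.trans hs.2
    rw [← intervalIntegral.integral_add_adjacent_intervals (intervalIntegrable_coeFn x h0 ha)
      (intervalIntegrable_coeFn x ha ht1), hX, zero_add, Real.norm_eq_abs]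
    refine Real.abs_le_sqrt ((sq_intervalIntegral_le ht.1.le (intervalIntegrable_coeFn x ha ht1)
      (intervalIntegrable_of_integrable hsq ha ht1)).trans ?_)
    have hsplit := intervalIntegral.integral_add_adjacent_intervals
      (intervalIntegrable_of_integrable hsq ha ht1) (intervalIntegrable_of_integrable hsq ht1 hb)
    refine mul_le_mul (by linarith) ?_ (hint0 ht.1.le) (sub_nonneg.2 hab)
    linarith [hint0 htb]
  have hXint : ∀ {c d : ℝ}, c ∈ Icc (0 : ℝ) 1 → d ∈ Icc (0 : ℝ) 1 →
      IntervalIntegrable (fun t => ∫ r in (0 : ℝ)..t, x r) volume c d := fun hc hd =>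
    ((continuousOn_primitive x).mono (ordConnected_Icc.uIcc_subset hc hd)).intervalIntegrable
  have hWle : |∫ t in (0 : ℝ)..s, ∫ r in (0 : ℝ)..t, x r| ≤ √M * (s - a) := by
    rw [← intervalIntegral.integral_add_adjacent_intervals (hXint h0 ha) (hXint ha hs1), hW,
      zero_add, ← abs_of_pos (sub_pos.2 hs.1)]
    exact intervalIntegral.norm_integral_le_of_norm_le_const hXle
  -- `(s - a) / s` increases with `s`.
  have hfrac : (s - a) / s ≤ (b - a) / b := by
    rw [div_le_div_iff₀ hs0 hb0]
    nlinarith [mul_le_mul_of_nonneg_left hs.2 ha.1]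
  have habs : |1 / s * ∫ t in (0 : ℝ)..s, ∫ r in (0 : ℝ)..t, x r| ≤ (b - a) / b * √M := by
    rw [abs_mul, abs_of_pos (one_div_pos.2 hs0)]
    calc 1 / s * |∫ t in (0 : ℝ)..s, ∫ r in (0 : ℝ)..t, x r|
        ≤ 1 / s * (√M * (s - a)) := by gcongr
      _ = (s - a) / s * √M := by ring
      _ ≤ (b - a) / b * √M := by gcongr
  calc (1 / s * ∫ t in (0 : ℝ)..s, ∫ r in (0 : ℝ)..t, x r) ^ 2
      = |1 / s * ∫ t in (0 : ℝ)..s, ∫ r in (0 : ℝ)..t, x r| ^ 2 := (sq_abs _).symm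
    _ ≤ ((b - a) / b * √M) ^ 2 := by gcongr
    _ = ((b - a) / b) ^ 2 * M := by rw [mul_pow, Real.sq_sqrt hM0]

lemma coeFn_cesaroOp_integrationOp (x : L2) : cesaroOp (integrationOp x) =ᵐ[unitVolume]
    fun s => 1 / s * ∫ t in (0 : ℝ)..s, ∫ r in (0 : ℝ)..t, x r := by
  filter_upwards [coeFn_cesaroOp (integrationOp x), ae_restrict_mem measurableSet_Ioo] with s h hs
  rw [h, intervalIntegral_integrationOp x ⟨le_rfl, zero_le_one⟩ (Ioo_subset_Icc_self hs)]

lemma integral_sq_cesaroOp_integrationOp_le {x : L2} {a b : ℝ} (ha : a ∈ Icc (0 : ℝ) 1)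
    (hb : b ∈ Icc (0 : ℝ) 1) (hab : a < b) (hX : ∫ t in (0 : ℝ)..a, x t = 0)
    (hW : ∫ t in (0 : ℝ)..a, ∫ r in (0 : ℝ)..t, x r = 0) :
    ∫ s in a..b, cesaroOp (integrationOp x) s ^ 2
      ≤ ((b - a) ^ 2 / b) ^ 2 * ∫ t in a..b, x t ^ 2 := by
  have hsq : Integrable (fun t => cesaroOp (integrationOp x) t ^ 2) unitVolume :=
    (Lp.memLp (cesaroOp (integrationOp x))).integrable_sq
  have hae : ∀ᵐ s ∂volume.restrict (Ioc a b), cesaroOp (integrationOp x) s ^ 2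
      ≤ ((b - a) / b) ^ 2 * ((b - a) * ∫ t in a..b, x t ^ 2) := by
    rw [ae_restrict_iff' measurableSet_Ioc]
    filter_upwards [ae_Ioc_of_ae_unitVolume (coeFn_cesaroOp_integrationOp x)] with s h hs
    rw [h ⟨ha.1.trans_lt hs.1, hs.2.trans hb.2⟩]
    exact sq_average_primitive_le ha hb hX hW hs
  have h := intervalIntegral.integral_mono_ae_restrict hab.le
    (intervalIntegrable_of_integrable hsq ha hb)
    (g := fun _ => ((b - a) / b) ^ 2 * ((b - a) * ∫ t in a..b, x t ^ 2))
    intervalIntegrable_const (by rwa [restrict_Ioc_eq_restrict_Icc] at hae)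
  refine h.trans (le_of_eq ?_)
  rw [intervalIntegral.integral_const, smul_eq_mul]
  ring

lemma norm_cesaroOp_integrationOp_le {n : ℕ} (hn : 0 < n) {x : L2}
    (hX : ∀ j < n, ∫ t in node n j..node n (j + 1), x t = 0)
    (hW : ∀ j < n, ∫ t in node n j..node n (j + 1), integrationOp x t = 0) :
    ‖cesaroOp (integrationOp x)‖ ≤ 4 / (n : ℝ) ^ 2 * ‖x‖ := by
  have hn' : (n : ℝ) ≠ 0 := by exact_mod_cast hn.ne'
  have h0 : node n 0 = 0 := by simp [node]
  have h1 : node n n = 1 := by simp [node, hn']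
  have hmem : ∀ {j}, j < n → node n j ∈ Icc (0 : ℝ) 1 ∧ node n (j + 1) ∈ Icc (0 : ℝ) 1 :=
    fun hj => ⟨node_mem_Icc hj.le, node_mem_Icc hj⟩
  have hvanish : ∀ y : L2, (∀ j < n, ∫ t in node n j..node n (j + 1), y t = 0) →
      ∀ j < n, ∫ t in (0 : ℝ)..node n j, y t = 0 := fun y hy j hj => by
    have h := intervalIntegral.sum_integral_adjacent_intervals (f := y) (μ := volume)
      (a := node n) (n := j) fun k hk =>
        intervalIntegrable_coeFn y (hmem (hk.trans hj)).1 (hmem (hk.trans hj)).2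
    rw [h0] at h
    rw [← h]
    exact Finset.sum_eq_zero fun k hk => hy k ((Finset.mem_range.1 hk).trans hj)
  have hsum : ∀ y : L2, ‖y‖ ^ 2
      = ∑ j ∈ Finset.range n, ∫ t in node n j..node n (j + 1), y t ^ 2 := fun y => by
    rw [norm_sq_eq_intervalIntegral, intervalIntegral.sum_integral_adjacent_intervals
      (f := fun t => y t ^ 2) (a := node n) fun k hk => intervalIntegrable_of_integrable
        (Lp.memLp y).integrable_sq (hmem hk).1 (hmem hk).2, h0, h1]
  refine abs_le_of_sq_le_sq' ?_ (by positivity) |>.2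
  rw [mul_pow, hsum, hsum, Finset.mul_sum]
  refine Finset.sum_le_sum fun j hj => ?_
  have hj := Finset.mem_range.1 hj
  obtain ⟨ha, hb⟩ := hmem hj
  have hlt := node_lt_node_succ hn j
  have hW' := hvanish _ hW j hj
  rw [intervalIntegral_integrationOp x ⟨le_rfl, zero_le_one⟩ ha] at hW'
  refine (integral_sq_cesaroOp_integrationOp_le ha hb hlt (hvanish x hX j hj) hW').trans ?_
  have hnn : 0 ≤ ∫ t in node n j..node n (j + 1), x t ^ 2 :=
    intervalIntegral.integral_nonneg hlt.le fun t _ => sq_nonneg _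
  have := node_sub_sq_div_le hn j
  have : 0 ≤ (node n (j + 1) - node n j) ^ 2 / node n (j + 1) := div_nonneg (sq_nonneg _) hb.1
  gcongr

/-- The indicator function of the `j`-th mesh interval. -/
noncomputable def meshVec (n j : ℕ) : L2 :=
  indicatorConstLp 2 (measurableSet_Ioc (a := node n j) (b := node n (j + 1)))
    (measure_ne_top unitVolume _) (1 : ℝ)

lemma inner_meshVec {n j : ℕ} (hj : j < n) (x : L2) :
    ⟪meshVec n j, x⟫_ℝ = ∫ t in node n j..node n (j + 1), x t := by
  have hle := (node_lt_node_succ (Nat.zero_lt_of_lt hj) j).le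
  have hres : unitVolume.restrict (Ioc (node n j) (node n (j + 1)))
      = volume.restrict (Ioc (node n j) (node n (j + 1))) := by
    rw [unitVolume, Measure.restrict_congr_set Ioo_ae_eq_Ioc,
      Measure.restrict_restrict measurableSet_Ioc,
      inter_eq_left.2 (Ioc_subset_Ioc (node_mem_Icc hj.le).1 (node_mem_Icc hj).2)]
  rw [meshVec, L2.inner_indicatorConstLp_one, intervalIntegral.integral_of_le hle, hres]

/-- The `2n` vectors to which `x` has to be orthogonal: the `j`-th vectors of the two families
test the mean values of `x` and of `Jx` over the `j`-th mesh interval. -/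
noncomputable def testVec (n : ℕ) : Fin n ⊕ Fin n → L2 :=
  Sum.elim (fun j => meshVec n j) fun j => integrationOp.adjoint (meshVec n j)

lemma norm_le_of_orthogonal_testVec {n : ℕ} (hn : 0 < n) {x : L2}
    (hx : ∀ i, ⟪testVec n i, x⟫_ℝ = 0) :
    ‖(cesaroOp ∘L integrationOp) x‖ ≤ 4 / (n : ℝ) ^ 2 * ‖x‖ := by
  refine norm_cesaroOp_integrationOp_le hn (fun j hj => ?_) fun j hj => ?_
  · rw [← inner_meshVec hj]
    exact hx (Sum.inl ⟨j, hj⟩)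
  · rw [← inner_meshVec hj, ← ContinuousLinearMap.adjoint_inner_left]
    exact hx (Sum.inr ⟨j, hj⟩)

/-! ### The operator `C ∘ J` -/

lemma cesaroOp_integrationOp_injective : Function.Injective (cesaroOp ∘L integrationOp) :=
  cesaroOp_injective.comp integrationOp_injective

lemma isCompactOperator_cesaroOp_integrationOp :
    IsCompactOperator (cesaroOp ∘L integrationOp) := by
  refine isCompactOperator_of_forall_orthogonal_norm_le fun ε hε => ?_
  have hlim : Tendsto (fun n : ℕ => 4 / (n : ℝ) ^ 2) atTop (𝓝 0) :=
    tendsto_const_nhds.div_atTop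
      ((tendsto_pow_atTop two_ne_zero).comp tendsto_natCast_atTop_atTop)
  obtain ⟨n, hnε, hn⟩ := ((hlim.eventually_lt_const hε).and (eventually_gt_atTop 0)).exists
  refine ⟨n + n, testVec n ∘ finSumFinEquiv.symm, fun x hx => ?_⟩
  refine (norm_le_of_orthogonal_testVec hn fun i => ?_).trans
    (mul_le_mul_of_nonneg_right hnε.le (norm_nonneg x))
  simpa using hx (finSumFinEquiv i)

lemma singularValue_lower_bound {σ : ℕ → ℝ}
    (h : IsSingularValueSeq (cesaroOp ∘L integrationOp) σ) (n : ℕ) :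
    ((((n : ℝ) + 1) * Real.pi) ^ 2)⁻¹ ≤ σ n := by
  obtain ⟨u, v, huv⟩ := h
  exact huv.le_of_forall_le_norm (orthonormal_cosineVec.comp _ Fin.val_injective)
    mul_norm_sum_cosineVec_le

lemma singularValue_upper_bound {σ : ℕ → ℝ}
    (h : IsSingularValueSeq (cesaroOp ∘L integrationOp) σ) {n : ℕ} (hn : 0 < n) :
    σ (n + n) ≤ 4 / (n : ℝ) ^ 2 := by
  obtain ⟨u, v, huv⟩ := h
  have := le_of_forall_orthogonal_norm_le huv.orthonormal_left huv.orthonormal_right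
    (fun n => (huv.pos n).le) huv.antitone huv.map_left (testVec n)
    fun x => norm_le_of_orthogonal_testVec hn
  simpa using this

lemma asympEquiv_singularValue {σ : ℕ → ℝ}
    (h : IsSingularValueSeq (cesaroOp ∘L integrationOp) σ) :
    AsympEquiv (fun n => σ (n - 1)) (fun n => 1 / (n : ℝ) ^ 2) := by
  have hpi := Real.pi_gt_three
  refine ⟨1 / Real.pi ^ 2, 64, by positivity, ?_, ?_⟩
  · rw [div_le_iff₀ (by positivity)]
    nlinarith
  filter_upwards [eventually_ge_atTop 4] with N hN
  constructor
  · have := singularValue_lower_bound h (N - 1)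
    rw [Nat.cast_sub (by omega), Nat.cast_one, sub_add_cancel] at this
    refine le_trans (le_of_eq ?_) this
    rw [mul_pow, mul_inv, mul_comm, one_div, one_div]
  · obtain ⟨n, hn0, hn, hN4⟩ : ∃ n, 0 < n ∧ n + n ≤ N - 1 ∧ N ≤ 4 * n :=
      ⟨(N - 1) / 2, by omega, by omega, by omega⟩
    have hanti : Antitone σ := h.choose_spec.choose_spec.antitone
    have hn' : (0 : ℝ) < n := by exact_mod_cast hn0
    have hN' : (N : ℝ) ≤ 4 * n := by exact_mod_cast hN4
    have hN0 : (0 : ℝ) < N := by exact_mod_cast (by omega : 0 < N)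
    refine (hanti hn).trans ((singularValue_upper_bound h hn0).trans ?_)
    rw [mul_one_div, div_le_div_iff₀ (by positivity) (by positivity)]
    nlinarith

/-! ### The degree of ill-posedness -/

lemma AsympEquiv.tendsto_neg_log_div_log {a : ℕ → ℝ}
    (h : AsympEquiv a (fun n => 1 / (n : ℝ) ^ 2)) :
    Tendsto (fun n : ℕ => -Real.log (a n) / Real.log n) atTop (𝓝 2) := by
  obtain ⟨c, C, hc, hcC, hev⟩ := h
  have hlog : Tendsto (fun n : ℕ => Real.log n) atTop atTop :=
    Real.tendsto_log_atTop.comp tendsto_natCast_atTop_atTop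
  have hlim : ∀ K : ℝ, Tendsto (fun n : ℕ => 2 - Real.log K / Real.log n) atTop (𝓝 2) :=
    fun K => by simpa using (tendsto_const_nhds.div_atTop hlog).const_sub 2
  have hlogmul : ∀ K : ℝ, 0 < K → ∀ n : ℕ, 1 < n →
      2 - Real.log K / Real.log n = -Real.log (K * (1 / (n : ℝ) ^ 2)) / Real.log n :=
    fun K hK n hn => by
      have hn' : (1 : ℝ) < n := by exact_mod_cast hn
      have := (Real.log_pos hn').ne'
      rw [Real.log_mul hK.ne' (by positivity), one_div, Real.log_inv, Real.log_pow]
      field_simp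
      push_cast
      ring
  refine tendsto_of_tendsto_of_tendsto_of_le_of_le' (hlim C) (hlim c) ?_ ?_ <;>
    filter_upwards [hev, eventually_gt_atTop 1] with n hn h1
  all_goals
    have hn' : (1 : ℝ) < n := by exact_mod_cast h1
    have hl := Real.log_pos hn'
    have hcn : 0 < c * (1 / (n : ℝ) ^ 2) := by positivity
  · rw [hlogmul C (hc.trans_le hcC) n h1]
    have := Real.log_le_log (hcn.trans_le hn.1) hn.2
    gcongr
  · rw [hlogmul c hc n h1]
    have := Real.log_le_log hcn hn.1
    gcongr

end CesaroIllPosed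

/-- The operator `A = C ∘ J` on `L²(0,1)` has a sequence `σ` of singular values, it satisfies
`σₙ ≍ n⁻²`, and `A` is ill-posed of degree exactly two. -/
theorem theorem4p4 :
    (∃ σ : ℕ → ℝ, CesaroIllPosed.IsSingularValueSeq
      (CesaroIllPosed.cesaroOp ∘L CesaroIllPosed.integrationOp) σ) ∧
    (∀ σ : ℕ → ℝ, CesaroIllPosed.IsSingularValueSeq
        (CesaroIllPosed.cesaroOp ∘L CesaroIllPosed.integrationOp) σ →
      CesaroIllPosed.AsympEquiv (fun n => σ (n - 1)) (fun n => 1 / (n : ℝ) ^ 2)) ∧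
    CesaroIllPosed.IsIllPosedOfDegree
      (CesaroIllPosed.cesaroOp ∘L CesaroIllPosed.integrationOp) 2 := by
  have hex := CesaroIllPosed.exists_isSingularValueSeq
    CesaroIllPosed.isCompactOperator_cesaroOp_integrationOp
    CesaroIllPosed.cesaroOp_integrationOp_injective CesaroIllPosed.not_finiteDimensional_L2
  have hlim : ∀ σ : ℕ → ℝ, CesaroIllPosed.IsSingularValueSeq
      (CesaroIllPosed.cesaroOp ∘L CesaroIllPosed.integrationOp) σ →
      Tendsto (fun n : ℕ => ((-Real.log (σ (n - 1)) / Real.log n : ℝ) : EReal)) atTop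
        (𝓝 ((2 : ℝ) : EReal)) := fun σ hσ =>
    (continuous_coe_real_ereal.tendsto 2).comp
      (CesaroIllPosed.asympEquiv_singularValue hσ).tendsto_neg_log_div_log
  exact ⟨hex, fun σ hσ => CesaroIllPosed.asympEquiv_singularValue hσ,
    { injective := CesaroIllPosed.cesaroOp_integrationOp_injective
      compact := CesaroIllPosed.isCompactOperator_cesaroOp_integrationOp
      degree_pos := two_pos
      exists_seq := hex
      lower_eq := fun σ hσ => (hlim σ hσ).liminf_eq
      upper_eq := fun σ hσ => (hlim σ hσ).limsup_eq }⟩
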